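/- A contingency matrix of size $p\times q$ is a $p\times q$ matrix of nonnegative integers in which every row and every column contains at least one nonzero entry; its weight is the sum of all its entries. Let $\mathfrak{m}_{pq}(n)$ be the number of contingency matrices of size $p\times q$ and weight $n$, and let the contingency metamatrix be the $n\times n$ matrix $\mathfrak{M}(n)=\|\mathfrak{m}_{pq}(n)\|_{p,q=1,\dots,n}$. Then for every $n$ the matrix $\mathfrak{M}(n)$ is totally positive, i.e., all of its minors of all sizes are (strictly) positive: for every $1\le k\le n$ and all indices $1\le p_1<\dots<p_k\le n$ and $1\le q_1<\dots<q_k\le n$, $$\det\bigl(\mathfrak{m}_{p_a q_b}(n)\bigr)_{a,b=1}^{k}>0 .$$ -/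

import Mathlib

/-- A `p × q` contingency matrix: a matrix of nonnegative integers in which every row and every
column contains a nonzero entry. -/
def IsContingency {p q : ℕ} (A : Matrix (Fin p) (Fin q) ℕ) : Prop :=
  (∀ i, ∃ j, A i j ≠ 0) ∧ (∀ j, ∃ i, A i j ≠ 0)

/-- The weight of a matrix of nonnegative integers: the sum of all its entries. -/
def matrixWeight {p q : ℕ} (A : Matrix (Fin p) (Fin q) ℕ) : ℕ :=
  ∑ i, ∑ j, A i j

/-- The set of contingency matrices of size `p × q` and weight `n`. -/
def contingencyMatrices (p q n : ℕ) : Set (Matrix (Fin p) (Fin q) ℕ) :=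
  {A | IsContingency A ∧ matrixWeight A = n}

/-- There are finitely many of them, so `Set.ncard` below is a genuine count. -/
theorem contingencyMatrices_finite (p q n : ℕ) : (contingencyMatrices p q n).Finite := by
  have h : (Set.univ.pi fun _ : Fin p => Set.univ.pi fun _ : Fin q => Set.Iic n).Finite :=
    Set.Finite.pi fun _ => Set.Finite.pi fun _ => Set.finite_Iic n
  refine h.subset ?_
  rintro A ⟨-, hA⟩ i - j -
  have h1 : A i j ≤ ∑ j', A i j' :=
    Finset.single_le_sum (f := fun j' => A i j') (fun _ _ => Nat.zero_le _) (Finset.mem_univ j)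
  have h2 : ∑ j', A i j' ≤ ∑ i', ∑ j', A i' j' :=
    Finset.single_le_sum (f := fun i' => ∑ j', A i' j') (fun _ _ => Nat.zero_le _)
      (Finset.mem_univ i)
  exact (h1.trans h2).trans hA.le

/-- The number of contingency matrices of size `p × q` and weight `n`. -/
noncomputable def contingencyCount (p q n : ℕ) : ℕ :=
  (contingencyMatrices p q n).ncard

/-- The contingency metamatrix: the `n × n` matrix whose entry in row `p` and column `q`,
`1 ≤ p, q ≤ n`, is the number of `p × q` contingency matrices of weight `n`
(`Fin n` counts from `0`, hence the shift). -/
noncomputable def contingencyMetamatrix (n : ℕ) : Matrix (Fin n) (Fin n) ℤ :=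
  Matrix.of fun p q => (contingencyCount (p.val + 1) (q.val + 1) n : ℤ)

/-- A matrix is totally positive if all its minors of all sizes are (strictly) positive; the minor
is the determinant of the submatrix on rows `r 0 < r 1 < ⋯` and columns `c 0 < c 1 < ⋯`. -/
def IsTotallyPositive {m n : ℕ} {R : Type*} [CommRing R] [LT R]
    (A : Matrix (Fin m) (Fin n) R) : Prop :=
  ∀ (k : ℕ) (r : Fin k → Fin m) (c : Fin k → Fin n), StrictMono r → StrictMono c →
    0 < (A.submatrix r c).det

/-! Without the nonzero-line conditions, `s × t` matrices of weight `n` number `(s * t).multichoose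
n`, and `n!` times this is the rising factorial of `st`, a combination of the powers `s ^ k * t ^ k`
with positive coefficients `c k` for `1 ≤ k ≤ n`. Inclusion–exclusion over rows and columns turns `s
^ k` and `t ^ k` into surjection numbers, so `n!` times the metamatrix is `Sᵀ * diag c * S` with `S
k p = surjCount k p` (`factorial_mul_contingencyCount`). By Cauchy–Binet each minor is, up to a
positive factor, a sum of products of two minors of the triangular array `S`. These are nonnegative,
and positive when the column indices are bounded entrywise by the row indices (`surjCount_minor`);
some row set dominates both given index sets. -/

/-- **Cauchy–Binet formula**, in the form of a sum over all functions, each index set being counted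
`(card m)!` times. -/
theorem Matrix.factorial_mul_det_sum {m ι R : Type*} [Fintype m] [DecidableEq m] [Fintype ι]
    [DecidableEq ι] [CommRing R] (c : ι → R) (U V : ι → m → R) :
    ((Fintype.card m).factorial : R) * (Matrix.of fun a b => ∑ x, c x * U x a * V x b).det =
      ∑ f : m → ι, (∏ a, c (f a)) *
        ((Matrix.of fun a b => U (f a) b).det * (Matrix.of fun a b => V (f a) b).det) := by
  have expand : (Matrix.of fun a b => ∑ x, c x * U x a * V x b).det =
      ∑ f : m → ι, (∏ a, c (f a)) * (∏ a, U (f a) a) * (Matrix.of fun a b => V (f a) b).det := by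
    have h1 : (Matrix.of fun a b => ∑ x, c x * U x a * V x b) =
        fun a => ∑ x, (c x * U x a) • V x := by
      ext a b
      simp [Finset.sum_apply]
    rw [h1]
    refine (Matrix.detRowAlternating.toMultilinearMap.map_sum _).trans ?_
    refine Finset.sum_congr rfl fun f _ => ?_
    rw [MultilinearMap.map_smul_univ, Finset.prod_mul_distrib]
    rfl
  -- Reindexing `f` by `σ` costs a sign in the `V`-minor; summing over all `σ` then assembles the
  -- `U`-minor and produces the factorial.
  have symm : ∀ σ : Equiv.Perm m, (Matrix.of fun a b => ∑ x, c x * U x a * V x b).det =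
      ∑ f : m → ι, (∏ a, c (f a)) * (((Equiv.Perm.sign σ : ℤ) : R) * ∏ a, U (f (σ a)) a) *
        (Matrix.of fun a b => V (f a) b).det := by
    intro σ
    rw [expand, ← (Equiv.arrowCongr σ.symm (Equiv.refl ι)).sum_comp]
    refine Finset.sum_congr rfl fun f _ => ?_
    have h2 : (Matrix.of fun a b => V ((Equiv.arrowCongr σ.symm (Equiv.refl ι)) f a) b) =
        (Matrix.of fun a b => V (f a) b).submatrix σ id := by
      ext a b
      simp
    rw [h2, Matrix.det_permute]
    have h3 : ∏ a, c ((Equiv.arrowCongr σ.symm (Equiv.refl ι)) f a) = ∏ a, c (f a) := by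
      simpa using Equiv.prod_comp σ fun a => c (f a)
    rw [h3]
    simp only [Equiv.arrowCongr_apply, Equiv.symm_symm, Function.comp_apply, Equiv.refl_apply]
    ring
  calc _ = ∑ σ : Equiv.Perm m, (Matrix.of fun a b => ∑ x, c x * U x a * V x b).det := by
        simp [Fintype.card_perm]
    _ = _ := by
        rw [Finset.sum_congr rfl fun σ _ => symm σ, Finset.sum_comm]
        refine Finset.sum_congr rfl fun f _ => ?_
        rw [Matrix.det_apply' (Matrix.of fun a b => U (f a) b), Finset.sum_mul, Finset.mul_sum]
        refine Finset.sum_congr rfl fun σ _ => ?_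
        simp only [Matrix.of_apply]
        ring

/-- If minors of `U` and `V` on increasing rows are nonnegative, then the product of the minors on
any family of rows is nonnegative. -/
theorem Matrix.det_mul_det_nonneg_of_strictMono {r : ℕ} {ι : Type*} [LinearOrder ι]
    {U V : ι → Fin r → ℤ}
    (hU : ∀ g : Fin r → ι, StrictMono g → 0 ≤ (Matrix.of fun a b => U (g a) b).det)
    (hV : ∀ g : Fin r → ι, StrictMono g → 0 ≤ (Matrix.of fun a b => V (g a) b).det)
    (f : Fin r → ι) :
    0 ≤ (Matrix.of fun a b => U (f a) b).det * (Matrix.of fun a b => V (f a) b).det := by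
  by_cases hf : Function.Injective f
  · have hg : StrictMono (f ∘ Tuple.sort f) :=
      (Tuple.monotone_sort f).strictMono_of_injective (hf.comp (Tuple.sort f).injective)
    have key : ∀ W : ι → Fin r → ℤ, (Matrix.of fun a b => W ((f ∘ Tuple.sort f) a) b).det =
        (Equiv.Perm.sign (Tuple.sort f) : ℤ) * (Matrix.of fun a b => W (f a) b).det := by
      intro W
      exact Matrix.det_permute (Tuple.sort f) (Matrix.of fun a b => W (f a) b)
    have := mul_nonneg (hU _ hg) (hV _ hg)
    rw [key U, key V] at this
    rcases Int.units_eq_one_or (Equiv.Perm.sign (Tuple.sort f)) with h | h <;>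
      simpa [h] using this
  · obtain ⟨i, j, hij, hne⟩ : ∃ i j, f i = f j ∧ i ≠ j := by
      simpa [Function.Injective] using hf
    rw [Matrix.det_zero_of_row_eq hne (by ext b; simp [hij]), zero_mul]

/-- The total positivity statement for triangular arrays defined by a two-term recurrence with
positive coefficients. -/
theorem Matrix.det_triangular_array {T : ℕ → ℕ → ℤ} {u v : ℕ → ℤ} (hu : ∀ i, 0 < u i)
    (hv : ∀ i, 0 < v i) (T00 : T 0 0 = 1) (T0 : ∀ i, T 0 (i + 1) = 0)
    (Tz : ∀ k, T (k + 1) 0 = u 0 * T k 0)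
    (Ts : ∀ k i, T (k + 1) (i + 1) = u (i + 1) * T k (i + 1) + v i * T k i) :
    ∀ (N r : ℕ) (K P : Fin r → ℕ), StrictMono K → StrictMono P → (r + ∑ a, K a ≤ N) →
      0 ≤ (Matrix.of fun a b => T (K a) (P b)).det ∧
      ((∀ a, P a ≤ K a) → 0 < (Matrix.of fun a b => T (K a) (P b)).det) := by
  -- `N` bounds size plus sum of row indices: deleting the row `K 0 = 0` lowers the size, and
  -- applying the recurrence lowers every row index.
  intro N
  induction N with
  | zero =>
    intro r K P _ _ h
    obtain rfl : r = 0 := by omega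
    simp
  | succ N ih =>
    intro r K P hK hP h
    rcases r with _ | r
    · simp
    by_cases hK0 : K 0 = 0
    · have hsub := ih r (fun a => K a.succ) (fun a => P a.succ)
        (hK.comp (Fin.strictMono_succ)) (hP.comp (Fin.strictMono_succ)) (by
          rw [Fin.sum_univ_succ] at h; omega)
      by_cases hP0 : P 0 = 0
      · have hdet : (Matrix.of fun a b => T (K a) (P b)).det =
            (Matrix.of fun a b : Fin r => T (K a.succ) (P b.succ)).det := by
          rw [Matrix.det_succ_row_zero, Fin.sum_univ_succ, Finset.sum_eq_zero]
          · simp [hK0, hP0, T00]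
            rfl
          · intro b _
            have : P b.succ ≠ 0 := by have := hP (Fin.succ_pos b); omega
            obtain ⟨i, hi⟩ := Nat.exists_eq_succ_of_ne_zero this
            simp [hK0, hi, T0]
        rw [hdet]
        exact ⟨hsub.1, fun H => hsub.2 fun a => H a.succ⟩
      · have hdet : (Matrix.of fun a b => T (K a) (P b)).det = 0 := by
          refine Matrix.det_eq_zero_of_row_eq_zero 0 fun b => ?_
          have : P b ≠ 0 := by have := hP.monotone (Fin.zero_le b); omega
          obtain ⟨i, hi⟩ := Nat.exists_eq_succ_of_ne_zero this
          simp [hK0, hi, T0]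
        rw [hdet]
        refine ⟨le_rfl, fun H => ?_⟩
        have := H 0
        omega
    · have hKpos : ∀ a, 1 ≤ K a := fun a => by
        have := hK.monotone (Fin.zero_le a); omega
      -- one step of the recurrence in each column
      let w : ℕ → ℤ := fun p => if p = 0 then 0 else v (p - 1)
      have hw : ∀ p, 0 ≤ w p := fun p => by
        dsimp only [w]; split_ifs
        exacts [le_rfl, (hv _).le]
      have hrec : ∀ a b, T (K a) (P b) =
          u (P b) * T (K a - 1) (P b) + w (P b) * T (K a - 1) (P b - 1) := by
        intro a b
        obtain ⟨k, hk⟩ : ∃ k, K a = k + 1 := ⟨K a - 1, by have := hKpos a; omega⟩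
        rcases hp : P b with _ | p
        · simp [hk, Tz, w]
        · simp [hk, Ts, w]
      -- Multilinearity in the columns: those in `s` keep their index, the others move one to the
      -- left.
      let Q : Finset (Fin (r + 1)) → Fin (r + 1) → ℕ := fun s b => if b ∈ s then P b else P b - 1
      let e : Finset (Fin (r + 1)) → Fin (r + 1) → ℤ := fun s b =>
        if b ∈ s then u (P b) else w (P b)
      have hexp : (Matrix.of fun a b => T (K a) (P b)).det =
          ∑ s : Finset (Fin (r + 1)), (∏ b, e s b) *
            (Matrix.of fun a b => T (K a - 1) (Q s b)).det := by
        rw [← Matrix.det_transpose]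
        have h1 : (Matrix.of fun a b => T (K a) (P b)).transpose =
            (fun b => u (P b) • fun a => T (K a - 1) (P b)) +
            (fun b => w (P b) • fun a => T (K a - 1) (P b - 1)) := by
          ext b a
          simp [hrec a b]
        rw [h1]
        refine (Matrix.detRowAlternating.toMultilinearMap.map_add_univ _ _).trans ?_
        refine Finset.sum_congr rfl fun s _ => ?_
        rw [← Matrix.det_transpose (Matrix.of fun a b => T (K a - 1) (Q s b))]
        have h2 : s.piecewise (fun b => u (P b) • fun a => T (K a - 1) (P b))
            (fun b => w (P b) • fun a => T (K a - 1) (P b - 1)) =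
            fun b => e s b • fun a => T (K a - 1) (Q s b) := by
          ext b a
          by_cases hb : b ∈ s <;> simp [hb, e, Q]
        rw [h2, MultilinearMap.map_smul_univ]
        rfl
      have hK' : StrictMono fun a => K a - 1 := fun a b hab => by
        have := hK hab; have := hKpos a; dsimp only; omega
      have hsum : r + 1 + ∑ a, (K a - 1) ≤ N := by
        have : ∑ a, (K a - 1) < ∑ a, K a :=
          Finset.sum_lt_sum (fun a _ => Nat.sub_le _ _) ⟨0, Finset.mem_univ _, by
            have := hKpos 0; omega⟩
        omega
      have heq : ∀ s b, 0 ≤ e s b := fun s b => by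
        dsimp only [e]; split_ifs
        exacts [(hu _).le, hw _]
      have hterm : ∀ s, 0 ≤ (∏ b, e s b) * (Matrix.of fun a b => T (K a - 1) (Q s b)).det := by
        intro s
        by_cases hz : ∃ b, b ∉ s ∧ P b = 0
        · obtain ⟨b, hb, hPb⟩ := hz
          rw [Finset.prod_eq_zero (Finset.mem_univ b) (by simp [e, hb, w, hPb]), zero_mul]
        push Not at hz
        refine mul_nonneg (Finset.prod_nonneg fun b _ => heq s b) ?_
        have hmono : Monotone (Q s) := by
          intro a b hab
          rcases hab.eq_or_lt with rfl | hab
          · rfl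
          have := hP hab
          dsimp only [Q]
          split_ifs <;> omega
        by_cases hinj : Function.Injective (Q s)
        · exact (ih (r + 1) _ (Q s) hK' (hmono.strictMono_of_injective hinj) hsum).1
        · obtain ⟨i, j, hij, hne⟩ : ∃ i j, Q s i = Q s j ∧ i ≠ j := by
            simpa [Function.Injective] using hinj
          rw [Matrix.det_zero_of_column_eq hne fun a => by simp [hij]]
      rw [hexp]
      refine ⟨Finset.sum_nonneg fun s _ => hterm s, fun H => ?_⟩
      -- Shifting exactly the columns with `P b = K b` keeps the indices strictly increasing and at
      -- most `K - 1`.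
      refine Finset.sum_pos' (fun s _ => hterm s)
        ⟨Finset.univ.filter fun b => P b < K b, Finset.mem_univ _, ?_⟩
      refine mul_pos (Finset.prod_pos fun b _ => ?_)
        ((ih (r + 1) _ _ hK' ?_ hsum).2 ?_)
      · have := hKpos b
        have := H b
        dsimp only [e, w]
        simp only [Finset.mem_filter, Finset.mem_univ, true_and]
        split_ifs
        exacts [hu _, by omega, hv _]
      · intro a b hab
        have := hP hab
        have := hK hab
        have := H a
        have := H b
        have := hKpos a
        dsimp only [Q]
        simp only [Finset.mem_filter, Finset.mem_univ, true_and]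
        split_ifs <;> omega
      · intro a
        have := H a
        dsimp only [Q]
        simp only [Finset.mem_filter, Finset.mem_univ, true_and]
        split_ifs <;> omega

/-! ### Rising factorials and surjection numbers -/

open Polynomial in
theorem ascPochhammer_nat_coeff_pos : ∀ n k : ℕ, k < n → 0 < (ascPochhammer ℕ n).coeff (k + 1) := by
  intro n
  induction n with
  | zero => intro k hk; omega
  | succ n ih =>
    intro k hk
    rw [ascPochhammer_succ_right, mul_add, coeff_add, coeff_mul_X]
    rcases Nat.lt_succ_iff_lt_or_eq.mp hk with h | rfl
    · have := ih k h
      have hc : (n : ℕ[X]) = C n := by simp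
      rw [hc, coeff_mul_C]
      have : 0 < n := by omega
      positivity
    · have := monic_ascPochhammer ℕ k
      rw [Monic, leadingCoeff, ascPochhammer_natDegree] at this
      omega

theorem factorial_mul_multichoose (N n : ℕ) :
    n.factorial * N.multichoose n =
      ∑ k ∈ Finset.range (n + 1), (ascPochhammer ℕ n).coeff k * N ^ k := by
  rw [Nat.multichoose_eq, ← Nat.ascFactorial_eq_factorial_mul_choose',
    ← ascPochhammer_nat_eq_ascFactorial, Polynomial.eval_eq_sum_range, ascPochhammer_natDegree]

theorem card_piAntidiag_nat {ι : Type*} [DecidableEq ι] (s : Finset ι) (n : ℕ) :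
    (Finset.piAntidiag s n).card = s.card.multichoose n := by
  rw [← Finset.card_finsuppAntidiag_nat_eq_multichoose, Finset.finsuppAntidiag]
  simp

/-- The number of surjections from a `k`-element set to a `p`-element set, as a finite
difference. -/
noncomputable def surjCount (k p : ℕ) : ℤ := ((fwdDiff (1 : ℤ))^[p] fun x => x ^ k) 0

/-- Leibniz rule for differences: only two terms survive because the second difference of `x`
vanishes. -/
theorem fwdDiff_iter_id_mul (f : ℤ → ℤ) (p : ℕ) (y : ℤ) :
    ((fwdDiff (1 : ℤ))^[p + 1] fun x => x * f x) y =
      (y + (p + 1)) * ((fwdDiff (1 : ℤ))^[p + 1] f) y + (p + 1) * ((fwdDiff (1 : ℤ))^[p] f) y := by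
  induction p generalizing y with
  | zero => simp [fwdDiff]; ring
  | succ p ih =>
    rw [Function.iterate_succ_apply', fwdDiff, ih, ih, Function.iterate_succ_apply' _ (p + 1) f]
    have h : ((fwdDiff (1 : ℤ))^[p + 1] f) y =
      ((fwdDiff (1 : ℤ))^[p] f) (y + 1) - ((fwdDiff (1 : ℤ))^[p] f) y := by
      rw [Function.iterate_succ_apply', fwdDiff]
    simp only [fwdDiff]
    push_cast
    linear_combination -(p + 1 : ℤ) * h

theorem surjCount_succ_succ (k p : ℕ) :
    surjCount (k + 1) (p + 1) = (p + 1) * surjCount k (p + 1) + (p + 1) * surjCount k p := by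
  have := fwdDiff_iter_id_mul (fun x => x ^ k) p 0
  simpa [surjCount, pow_succ'] using this

theorem surjCount_succ_zero (k : ℕ) : surjCount (k + 1) 0 = 0 := by simp [surjCount]

theorem surjCount_zero_succ (p : ℕ) : surjCount 0 (p + 1) = 0 := by
  have : fwdDiff (1 : ℤ) (fun _ : ℤ => (1 : ℤ)) = 0 := by ext; simp [fwdDiff]
  have h0 : fwdDiff (1 : ℤ) (0 : ℤ → ℤ) = 0 := by ext; simp [fwdDiff]
  simp only [surjCount, pow_zero, Function.iterate_succ_apply, this]
  rw [Function.iterate_fixed h0]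
  rfl

theorem surjCount_zero_zero : surjCount 0 0 = 1 := by simp [surjCount]

/-- Summing over subsets rather than with binomial coefficients matches the inclusion–exclusion
below term by term. -/
theorem surjCount_eq_sum (k p : ℕ) :
    surjCount k p = ∑ s : Finset (Fin p), (-1) ^ (p - s.card) * (s.card : ℤ) ^ k := by
  rw [surjCount, fwdDiff_iter_eq_sum_shift]
  have := Finset.sum_powerset_apply_card (x := (Finset.univ : Finset (Fin p)))
    fun m => (-1 : ℤ) ^ (p - m) * (m : ℤ) ^ k
  rw [Finset.powerset_univ, Finset.card_univ, Fintype.card_fin] at this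
  rw [this]
  refine Finset.sum_congr rfl fun m _ => ?_
  simp
  ring

/-! ### Counting by inclusion–exclusion -/

/-- Inclusion–exclusion for a family of conditions. -/
theorem ite_forall_eq_sum {α : Type*} [Fintype α] [DecidableEq α] (Z : α → Prop)
    [Decidable (∀ i, ¬ Z i)] [∀ s : Finset α, Decidable (∀ i, i ∉ s → Z i)] :
    (if ∀ i, ¬ Z i then (1 : ℤ) else 0) =
      ∑ s : Finset α, (-1) ^ (Fintype.card α - s.card) * if ∀ i, i ∉ s → Z i then 1 else 0 := by
  classical
  have h1 : (if ∀ i, ¬ Z i then (1 : ℤ) else 0) = ∏ i, (1 + -(if Z i then (1 : ℤ) else 0)) := by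
    split_ifs with h
    · simp [h]
    · push Not at h
      obtain ⟨i, hi⟩ := h
      rw [Finset.prod_eq_zero (Finset.mem_univ i) (by simp [hi])]
  rw [h1, Finset.prod_add, Finset.powerset_univ]
  refine Finset.sum_congr rfl fun s _ => ?_
  rw [Finset.prod_const_one, one_mul, Finset.prod_neg, Finset.card_sdiff_of_subset (by simp),
    Finset.card_univ, Finset.prod_ite_zero]
  simp

/-- Here `s` and `t` are the rows and columns allowed to be nonzero, so each term counts matrices
supported on `s ×ˢ t`. -/
theorem contingencyCount_eq_sum (p q n : ℕ) :
    (contingencyCount p q n : ℤ) = ∑ s : Finset (Fin p), ∑ t : Finset (Fin q),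
      (-1) ^ (p - s.card) * (-1) ^ (q - t.card) * ((s.card * t.card).multichoose n : ℤ) := by
  let X : Finset (Fin p × Fin q → ℕ) := Finset.piAntidiag Finset.univ n
  have hcount : (contingencyCount p q n : ℤ) =
      ∑ A ∈ X, (if ∀ i, ¬ ∀ j, A (i, j) = 0 then (1 : ℤ) else 0) *
        (if ∀ j, ¬ ∀ i, A (i, j) = 0 then (1 : ℤ) else 0) := by
    have h1 : contingencyCount p q n = (X.filter fun A =>
        (∀ i, ¬ ∀ j, A (i, j) = 0) ∧ (∀ j, ¬ ∀ i, A (i, j) = 0)).card := by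
      rw [contingencyCount, ← Set.ncard_coe_finset]
      refine Set.ncard_congr (fun A _ x => A x.1 x.2) ?_ ?_ ?_
      · rintro A ⟨⟨hr, hc⟩, hw⟩
        simp only [X, Finset.coe_filter, Finset.mem_piAntidiag, Set.mem_ofPred_eq]
        refine ⟨⟨?_, by simp⟩, ?_, ?_⟩
        · exact (Fintype.sum_prod_type _).trans hw
        · simpa using hr
        · simpa using hc
      · intro A B _ _ h
        ext i j
        exact congrFun h (i, j)
      · intro A hA
        simp only [X, Finset.coe_filter, Finset.mem_piAntidiag, Set.mem_ofPred_eq] at hA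
        obtain ⟨⟨hw, -⟩, hr, hc⟩ := hA
        refine ⟨fun i j => A (i, j), ⟨⟨by simpa using hr, by simpa using hc⟩, ?_⟩, rfl⟩
        exact (Fintype.sum_prod_type _).symm.trans hw
    rw [h1, Finset.card_filter]
    push_cast
    refine Finset.sum_congr rfl fun A _ => ?_
    rw [ite_zero_mul_ite_zero, one_mul]
  rw [hcount]
  refine (Finset.sum_congr rfl fun A _ => congrArg₂ (· * ·)
    (ite_forall_eq_sum fun i => ∀ j, A (i, j) = 0)
    (ite_forall_eq_sum fun j => ∀ i, A (i, j) = 0)).trans ?_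
  simp_rw [Finset.sum_mul_sum]
  rw [Finset.sum_comm]
  refine Finset.sum_congr rfl fun s _ => ?_
  rw [Finset.sum_comm]
  refine Finset.sum_congr rfl fun t _ => ?_
  have h2 : ((s.card * t.card).multichoose n : ℤ) = ∑ A ∈ X,
      (if ∀ i, i ∉ s → ∀ j, A (i, j) = 0 then (1 : ℤ) else 0) *
        (if ∀ j, j ∉ t → ∀ i, A (i, j) = 0 then (1 : ℤ) else 0) := by
    rw [← Finset.card_product, ← card_piAntidiag_nat]
    have h3 : Finset.piAntidiag (s ×ˢ t) n = X.filter fun A =>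
        (∀ i, i ∉ s → ∀ j, A (i, j) = 0) ∧ (∀ j, j ∉ t → ∀ i, A (i, j) = 0) := by
      ext A
      simp only [X, Finset.mem_piAntidiag, Finset.mem_filter, Finset.mem_univ, Finset.mem_product,
        Prod.forall, implies_true, and_true]
      have h4 : (∀ i j, A (i, j) ≠ 0 → i ∈ s ∧ j ∈ t) ↔
          ((∀ i, i ∉ s → ∀ j, A (i, j) = 0) ∧ (∀ j, j ∉ t → ∀ i, A (i, j) = 0)) := by
        constructor
        · intro h
          exact ⟨fun i hi j => by_contra fun hA => hi (h i j hA).1,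
            fun j hj i => by_contra fun hA => hj (h i j hA).2⟩
        · rintro ⟨h, h'⟩ i j hA
          exact ⟨by_contra fun hi => hA (h i hi j), by_contra fun hj => hA (h' j hj i)⟩
      rw [h4]
      refine and_congr_left fun h => ?_
      rw [← Finset.sum_subset (Finset.subset_univ (s ×ˢ t))]
      rintro ⟨i, j⟩ _ hx
      rw [Finset.mem_product, not_and_or] at hx
      exact hx.elim (fun hi => h.1 i hi j) (fun hj => h.2 j hj i)
    rw [h3, Finset.card_filter]
    push_cast
    refine Finset.sum_congr rfl fun A _ => ?_
    rw [ite_zero_mul_ite_zero, one_mul]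
  rw [h2, Finset.mul_sum]
  refine Finset.sum_congr rfl fun A _ => ?_
  simp only [Fintype.card_fin]
  ring

/-- The factorization of the contingency metamatrix through Stirling numbers. -/
theorem factorial_mul_contingencyCount (p q n : ℕ) :
    (n.factorial : ℤ) * contingencyCount p q n = ∑ k ∈ Finset.range (n + 1),
      ((ascPochhammer ℕ n).coeff k : ℤ) * surjCount k p * surjCount k q := by
  have h : ∀ s t : ℕ, (n.factorial : ℤ) * ((s * t).multichoose n : ℤ) =
      ∑ k ∈ Finset.range (n + 1), ((ascPochhammer ℕ n).coeff k : ℤ) * (s : ℤ) ^ k * (t : ℤ) ^ k := by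
    intro s t
    have := factorial_mul_multichoose (s * t) n
    zify at this
    rw [this]
    refine Finset.sum_congr rfl fun k _ => ?_
    ring
  simp_rw [contingencyCount_eq_sum, surjCount_eq_sum, mul_assoc, Finset.sum_mul_sum,
    Finset.mul_sum]
  rw [Finset.sum_comm (s := Finset.range (n + 1))]
  refine Finset.sum_congr rfl fun s _ => ?_
  rw [Finset.sum_comm (s := Finset.range (n + 1))]
  refine Finset.sum_congr rfl fun t _ => ?_
  calc _ = (-1 : ℤ) ^ (p - s.card) * (-1) ^ (q - t.card) *
        (n.factorial * ((s.card * t.card).multichoose n : ℤ)) := by ring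
    _ = _ := by
      rw [h, Finset.mul_sum]
      refine Finset.sum_congr rfl fun k _ => ?_
      ring

/-! ### Total positivity -/

/-- The shift by one is needed for positive coefficients: in the unshifted recurrence the
coefficient at `p = 0` is zero. -/
theorem surjCount_minor {r : ℕ} {K P : Fin r → ℕ} (hK : StrictMono K) (hP : StrictMono P) :
    0 ≤ (Matrix.of fun a b => surjCount (K a + 1) (P b + 1)).det ∧
      ((∀ a, P a ≤ K a) → 0 < (Matrix.of fun a b => surjCount (K a + 1) (P b + 1)).det) :=
  Matrix.det_triangular_array (T := fun k p => surjCount (k + 1) (p + 1))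
    (u := fun i => i + 1) (v := fun i => i + 2) (fun i => by positivity) (fun i => by positivity)
    (by simp [surjCount_succ_succ, surjCount_zero_succ, surjCount_zero_zero])
    (fun i => by simp [surjCount_succ_succ 0, surjCount_zero_succ])
    (fun k => by simp [surjCount_succ_succ (k + 1), surjCount_succ_zero])
    (fun k i => by rw [surjCount_succ_succ (k + 1)]; push_cast; ring)
    _ r K P hK hP le_rfl

theorem corollaryA10 (n : ℕ) : IsTotallyPositive (contingencyMetamatrix n) := by
  intro k r c hr hc
  let C : Fin n → ℤ := fun x => ((ascPochhammer ℕ n).coeff (x + 1) : ℤ)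
  let U : Fin n → Fin k → ℤ := fun x a => surjCount (x + 1) (r a + 1)
  let V : Fin n → Fin k → ℤ := fun x a => surjCount (x + 1) (c a + 1)
  have hC : ∀ x, 0 < C x := fun x => by
    exact Nat.cast_pos.mpr (ascPochhammer_nat_coeff_pos n x x.2)
  have hM : (n.factorial : ℤ) • (contingencyMetamatrix n).submatrix r c =
      Matrix.of fun a b => ∑ x, C x * U x a * V x b := by
    ext a b
    have := factorial_mul_contingencyCount (r a + 1) (c b + 1) n
    rw [Finset.sum_range_succ', surjCount_zero_succ, mul_zero, zero_mul, add_zero,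
      Finset.sum_range] at this
    simpa [contingencyMetamatrix] using this
  have hdet := Matrix.factorial_mul_det_sum C U V
  rw [← hM, Matrix.det_smul] at hdet
  have hpos : 0 < ∑ f : Fin k → Fin n, (∏ a, C (f a)) *
      ((Matrix.of fun a b => U (f a) b).det * (Matrix.of fun a b => V (f a) b).det) := by
    have hU : ∀ g : Fin k → Fin n, StrictMono g → 0 ≤ (Matrix.of fun a b => U (g a) b).det :=
      fun g hg => (surjCount_minor (K := fun a => g a) (P := fun a => r a) hg hr).1
    have hV : ∀ g : Fin k → Fin n, StrictMono g → 0 ≤ (Matrix.of fun a b => V (g a) b).det :=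
      fun g hg => (surjCount_minor (K := fun a => g a) (P := fun a => c a) hg hc).1
    -- The entrywise maximum of `r` and `c` is strictly increasing and dominates both, so both its
    -- minors are positive.
    refine Finset.sum_pos' (fun f _ => mul_nonneg (Finset.prod_nonneg fun a _ => (hC _).le)
      (Matrix.det_mul_det_nonneg_of_strictMono hU hV f))
      ⟨fun a => max (r a) (c a), Finset.mem_univ _, ?_⟩
    have hm : StrictMono fun a => max (r a) (c a) := fun a b hab => max_lt_max (hr hab) (hc hab)
    refine mul_pos (Finset.prod_pos fun a _ => hC _) (mul_pos ?_ ?_)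
    · exact (surjCount_minor (K := fun a => (max (r a) (c a) : Fin n)) (P := fun a => r a) hm hr).2
        fun a => Fin.le_def.mp (le_max_left _ _)
    · exact (surjCount_minor (K := fun a => (max (r a) (c a) : Fin n)) (P := fun a => c a) hm hc).2
        fun a => Fin.le_def.mp (le_max_right _ _)
  rw [← hdet] at hpos
  exact pos_of_mul_pos_right (pos_of_mul_pos_right hpos (by positivity)) (by positivity)
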